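/- Let $n\ge 0$ and let $V:\mathbb{R}\to M_n(\mathbb{C})$ have Hermitian values $V(x)=V(x)^*$ and locally integrable entries with $\sup_{a\in\mathbb{R}}\int_a^{a+1}\|V(x)\|\,dx<\infty$ (for instance, $V$ locally integrable and periodic, or measurable and bounded). Let $H=-\frac{d^2}{dx^2}+V(x)$ on $L^2(\mathbb{R},\mathbb{C}^n)$, with domain the set of $u\in L^2(\mathbb{R},\mathbb{C}^n)$ that are differentiable with $u'$ locally absolutely continuous and $-u''+Vu\in L^2(\mathbb{R},\mathbb{C}^n)$, and let $z\notin\sigma(H)$. Let $\psi_\pm:\mathbb{R}\to M_n(\mathbb{C})$ be matrix solutions of $-\psi''+V\psi=z\psi$, and $\widetilde\psi_\pm:\mathbb{R}\to M_n(\mathbb{C})$ matrix solutions of the adjoint equation $-\widetilde\psi''+\widetilde\psi V=z\widetilde\psi$ (solutions being differentiable, with locally absolutely continuous derivative, and satisfying the equation almost everywhere), such that $\psi_+,\widetilde\psi_+$ are $L^2$ at $x=+\infty$ and $\psi_-,\widetilde\psi_-$ are $L^2$ at $x=-\infty$. With the Wronskian $W(\widetilde\psi,\psi)=\widetilde\psi\,\psi'-\widetilde\psi'\,\psi$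 (constant in $x$ for such solutions), suppose that they are normalized by $$W(\widetilde\psi_-,\psi_+)=\mathbf 1,\qquad W(\widetilde\psi_+,\psi_-)=-\mathbf 1 .$$ Then the Green's function of $H$ at $z$, i.e. the continuous integral kernel $G(x,x')$ of the resolvent $(H-z)^{-1}$, is $$G(x,x')=-\theta(x-x')\,\psi_+(x)\,\widetilde\psi_-(x')-\theta(x'-x)\,\psi_-(x)\,\widetilde\psi_+(x'),$$ where $\theta$ is the Heaviside function with $\theta(0)=\tfrac12$. That is, this $G$ is continuous on $\mathbb{R}\times\mathbb{R}$, and for every $f\in L^2(\mathbb{R},\mathbb{C}^n)$ the function $x'\mapsto G(x,x')f(x')$ is integrable for every $x$, and $\big((H-z)^{-1}f\big)(x)=\int_{\mathbb{R}}G(x,x')f(x')\,dx'$ for almost every $x$. -/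

import Mathlib

open MeasureTheory

namespace MatrixSchrodinger

/-- The Hilbert space `L²(ℝ, ℂⁿ)`. -/
abbrev L2 (n : ℕ) : Type := Lp (EuclideanSpace ℂ (Fin n)) 2 (volume : Measure ℝ)

/-- Matrix potentials: Hermitian values, locally integrable entries, with local integrals that are
bounded uniformly along the line. All bounded measurable and all periodic locally integrable
Hermitian matrix functions are of this kind. -/
structure IsPotential {n : ℕ} (V : ℝ → Matrix (Fin n) (Fin n) ℂ) : Prop where
  hermitian : ∀ x, (V x).IsHermitian
  locallyIntegrable : ∀ i j, LocallyIntegrable (fun x => V x i j) volume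
  uniform : ∃ C : ℝ, ∀ (a : ℝ) (i j : Fin n), ∫ x in a..(a + 1), ‖V x i j‖ ≤ C

/-- The graph of the Hamiltonian `H = -d²/dx² + V` acting on `L²(ℝ, ℂⁿ)`: `HamiltonianGraph V f g`
says that `f ∈ D(H)` and `H f = g`. The domain consists of those `f ∈ L²` that have a differentiable
representative `u` with locally absolutely continuous derivative and with `-u'' + V u ∈ L²`.
Local absolute continuity of `u'` together with `-u'' + V u = g` almost everywhere is written as
the integrated equation `u'(b) - u'(a) = ∫_a^b (V u - g)`. -/
def HamiltonianGraph {n : ℕ} (V : ℝ → Matrix (Fin n) (Fin n) ℂ) (f g : L2 n) : Prop :=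
  ∃ u : ℝ → EuclideanSpace ℂ (Fin n),
    (f =ᵐ[volume] u) ∧ Differentiable ℝ u ∧
    ∀ a b : ℝ, deriv u b - deriv u a =
      ∫ t in a..b, (Matrix.toEuclideanCLM (𝕜 := ℂ) (V t) (u t) - g t)

/-- The bounded operator `R` is the resolvent `(H - z)⁻¹`: its values lie in `D(H)`,
`(H - z) R f = f` for all `f ∈ L²`, and `R (H - z) f = f` for all `f ∈ D(H)`. -/
structure IsResolvent {n : ℕ} (V : ℝ → Matrix (Fin n) (Fin n) ℂ) (z : ℂ)
    (R : L2 n →L[ℂ] L2 n) : Prop where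
  right_inv : ∀ f : L2 n, HamiltonianGraph V (R f) (z • R f + f)
  left_inv : ∀ f g : L2 n, HamiltonianGraph V f g → R (g - z • f) = f

/-- The spectrum `σ(H)` of `H = -d²/dx² + V` on `L²(ℝ, ℂⁿ)`. -/
def spectrumH {n : ℕ} (V : ℝ → Matrix (Fin n) (Fin n) ℂ) : Set ℂ :=
  {z | ¬ ∃ R : L2 n →L[ℂ] L2 n, IsResolvent V z R}

/-- `G` is the Green's function of `H` at `z`: the (continuous) integral kernel of the resolvent
`(H - z)⁻¹`. -/
def IsGreensFunction {n : ℕ} (V : ℝ → Matrix (Fin n) (Fin n) ℂ) (z : ℂ)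
    (G : ℝ → ℝ → Matrix (Fin n) (Fin n) ℂ) : Prop :=
  Continuous (fun p : ℝ × ℝ => G p.1 p.2) ∧
  ∃ R : L2 n →L[ℂ] L2 n, IsResolvent V z R ∧
    ∀ f : L2 n,
      (∀ x : ℝ, Integrable (fun y => Matrix.toEuclideanCLM (𝕜 := ℂ) (G x y) (f y)) volume) ∧
      ∀ᵐ x ∂(volume : Measure ℝ),
        (R f) x = ∫ y, Matrix.toEuclideanCLM (𝕜 := ℂ) (G x y) (f y)

/-- Entrywise derivative of a matrix-valued function on the line. -/
noncomputable def mderiv {n : ℕ} (ψ : ℝ → Matrix (Fin n) (Fin n) ℂ) (x : ℝ) :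
    Matrix (Fin n) (Fin n) ℂ :=
  Matrix.of fun i j => deriv (fun t => ψ t i j) x

/-- `ψ` is a matrix solution of `-ψ'' + V ψ = z ψ` (its columns are the solutions): `ψ` is
differentiable and `ψ'` is locally absolutely continuous with `ψ'' = (V - z) ψ` almost everywhere,
in integrated form. For continuous `V` these are the classical solutions. -/
def IsSolution {n : ℕ} (V : ℝ → Matrix (Fin n) (Fin n) ℂ) (z : ℂ)
    (ψ : ℝ → Matrix (Fin n) (Fin n) ℂ) : Prop :=
  (∀ i j, Differentiable ℝ (fun x => ψ x i j)) ∧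
  ∀ (a b : ℝ) (i j : Fin n),
    mderiv ψ b i j - mderiv ψ a i j = ∫ t in a..b, (V t * ψ t - z • ψ t) i j

/-- `φ` is a matrix solution of the adjoint equation `-φ'' + φ V = z φ` (its rows are the
solutions), in the same sense. -/
def IsAdjointSolution {n : ℕ} (V : ℝ → Matrix (Fin n) (Fin n) ℂ) (z : ℂ)
    (φ : ℝ → Matrix (Fin n) (Fin n) ℂ) : Prop :=
  (∀ i j, Differentiable ℝ (fun x => φ x i j)) ∧
  ∀ (a b : ℝ) (i j : Fin n),
    mderiv φ b i j - mderiv φ a i j = ∫ t in a..b, (φ t * V t - z • φ t) i j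

/-- `ψ` is `L²` at `x = +∞`. -/
def L2AtTop {n : ℕ} (ψ : ℝ → Matrix (Fin n) (Fin n) ℂ) : Prop :=
  ∀ i j, MemLp (fun x => ψ x i j) 2 (volume.restrict (Set.Ioi (0 : ℝ)))

/-- `ψ` is `L²` at `x = -∞`. -/
def L2AtBot {n : ℕ} (ψ : ℝ → Matrix (Fin n) (Fin n) ℂ) : Prop :=
  ∀ i j, MemLp (fun x => ψ x i j) 2 (volume.restrict (Set.Iio (0 : ℝ)))

/-- The matrix Wronskian `W(φ, ψ; x) = φ(x) ψ'(x) - φ'(x) ψ(x)`. -/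
noncomputable def wronskian {n : ℕ} (φ ψ : ℝ → Matrix (Fin n) (Fin n) ℂ) (x : ℝ) :
    Matrix (Fin n) (Fin n) ℂ :=
  φ x * mderiv ψ x - mderiv φ x * ψ x

/-- The Heaviside function `θ`, with `θ(0) = 1/2`. -/
noncomputable def heaviside (x : ℝ) : ℂ :=
  if 0 < x then 1 else if x < 0 then 0 else 1 / 2

end MatrixSchrodinger

/-! As `z` is outside the spectrum, the resolvent `R` is given, and it remains to compute `u = R f`
pointwise. Write W for the Wronskian and φ± for the adjoint solutions. For `-u'' + (V - z) u = f`,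
Lagrange's identity (`wronskian_sub_eq_integral`) says that W(φ, u) is an antiderivative of `-φ f`.
If the boundary terms vanish at the end where φ± is square integrable, then W(φ₋, u)(x) = -∫_{-∞}^x
φ₋ f and W(φ₊, u)(x) = ∫_x^∞ φ₊ f.

The boundary terms vanish because the local L¹ norm of `V` is uniformly bounded:
`norm_le_of_second_order` bounds a solution and its derivative at `a` by the L² norm of the solution
and the L¹ norm of the source on `[a, a+1]`, and these tend to zero. The same decay gives W(φ₋, ψ₋)
= W(φ₊, ψ₊) = 0.

With the two normalizations, the four Wronskians state that a block matrix of the φ's is a left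
inverse of one of the ψ's. It is then a right inverse too (`completeness_of_wronskian`): ψ₊φ₋ = ψ₋φ₊
and ψ₋φ₊' - ψ₊φ₋' = 1. Hence ψ₊ W(φ₋, u) - ψ₋ W(φ₊, u) = u, which is the claimed integral formula;
the first identity also makes the kernel continuous on the diagonal. -/

namespace MatrixSchrodinger

open Filter Set Topology intervalIntegral Interval

/-! ### Product rule when one factor is only an indefinite integral -/

section Bilinear

variable {F G H : Type*} [NormedAddCommGroup F] [NormedSpace ℝ F]
  [NormedAddCommGroup G] [NormedSpace ℝ G] [NormedAddCommGroup H] [NormedSpace ℝ H]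

/-- The product of a continuous function and an integrable function under a bounded bilinear map
is interval integrable. -/
lemma intervalIntegrable_bilin (B : F →L[ℝ] G →L[ℝ] H) {p : ℝ → F} {q : ℝ → G} {a b : ℝ}
    (hp : Continuous p) (hq : IntervalIntegrable q volume a b) :
    IntervalIntegrable (fun t => B (p t) (q t)) volume a b := by
  obtain ⟨C, hC⟩ := (isCompact_uIcc (a := a) (b := b)).exists_bound_of_continuousOn hp.continuousOn
  rw [intervalIntegrable_iff] at hq ⊢
  refine Integrable.mono' (g := fun t => ‖B‖ * C * ‖q t‖) (hq.norm.const_mul _)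
    (B.aestronglyMeasurable_comp₂ hp.aestronglyMeasurable hq.aestronglyMeasurable) ?_
  refine (ae_restrict_iff' measurableSet_uIoc).2 (Eventually.of_forall fun t ht => ?_)
  refine (B.le_opNorm₂ _ _).trans ?_
  gcongr
  exact hC t (uIoc_subset_uIcc ht)

lemma continuous_of_sub_eq_integral {p q : ℝ → G}
    (hq : ∀ a b, IntervalIntegrable q volume a b) (hpq : ∀ a b, p b - p a = ∫ t in a..b, q t) :
    Continuous p := by
  have h : p = fun b => p 0 + ∫ t in (0 : ℝ)..b, q t := by
    funext b; rw [← hpq]; abel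
  rw [h]
  exact continuous_const.add (continuous_primitive hq 0)

/-- The integrand is at most a constant times `|y - x| * ‖q t‖`, and `∫ ‖q‖` over the shrinking
interval tends to zero, so the integral is `o(|y - x|)`. This holds at every `x`, not only at
Lebesgue points of `q`. -/
lemma hasDerivAt_integral_bilin_sub (B : F →L[ℝ] G →L[ℝ] H) {P : ℝ → F} {q : ℝ → G} {P' : F}
    {x : ℝ} (hP : HasDerivAt P P' x)
    (hq : ∀ a b, IntervalIntegrable q volume a b) :
    HasDerivAt (fun y => ∫ t in x..y, B (P t - P x) (q t)) 0 x := by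
  rw [hasDerivAt_iff_isLittleO, Asymptotics.isLittleO_iff]
  intro c hc
  have h1 : Tendsto (fun y => ∫ t in x..y, ‖q t‖) (𝓝 x) (𝓝 0) := by
    have := (continuous_primitive (f := fun t => ‖q t‖) (fun a b => (hq a b).norm) x).tendsto x
    simpa using this
  obtain ⟨K, hK⟩ := hP.isBigO_sub.bound
  set L : ℝ := ‖B‖ * |K| + 1 with hL
  have hLpos : 0 < L := by positivity
  have h2 : ∀ᶠ y in 𝓝 x, |∫ t in x..y, ‖q t‖| < c / L := by
    have := h1.abs
    rw [abs_zero] at this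
    exact this.eventually_lt_const (by positivity)
  obtain ⟨ε, hε, hball⟩ := Metric.eventually_nhds_iff.1 (hK.and h2)
  filter_upwards [Metric.ball_mem_nhds x hε] with y hy
  have hy' := (hball hy).2
  simp only [intervalIntegral.integral_same, sub_zero, smul_zero]
  have hbd : ∀ t ∈ Ι x y, ‖B (P t - P x) (q t)‖ ≤ (L * |y - x|) * ‖q t‖ := by
    intro t ht
    have htx : |t - x| ≤ |y - x| := abs_sub_left_of_mem_uIcc (uIoc_subset_uIcc ht)
    have htd : dist t x < ε := by
      rw [Real.dist_eq]; rw [Metric.mem_ball, Real.dist_eq] at hy; exact htx.trans_lt hy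
    have h3 := (hball htd).1
    rw [Real.norm_eq_abs] at h3
    refine (B.le_opNorm₂ _ _).trans ?_
    gcongr ?_ * _
    calc ‖B‖ * ‖P t - P x‖ ≤ ‖B‖ * (|K| * |y - x|) := by
          gcongr
          exact h3.trans (by gcongr; exact le_abs_self K)
      _ = (‖B‖ * |K|) * |y - x| := by ring
      _ ≤ L * |y - x| := by gcongr; rw [hL]; linarith
  have h4 := norm_integral_le_abs_of_norm_le (μ := volume)
    ((ae_restrict_iff' measurableSet_uIoc).2 (Eventually.of_forall hbd))
    ((hq x y).norm.const_mul _)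
  refine h4.trans ?_
  rw [intervalIntegral.integral_const_mul, abs_mul, abs_mul, abs_abs, abs_of_pos hLpos,
    Real.norm_eq_abs]
  calc L * |y - x| * |∫ t in x..y, ‖q t‖| ≤ L * |y - x| * (c / L) := by gcongr
    _ = c * |y - x| := by field_simp

/-- Product rule in integrated form, where one factor is `C¹` and the other one is an indefinite
integral. -/
lemma bilin_sub_eq_integral [CompleteSpace G] [CompleteSpace H] (B : F →L[ℝ] G →L[ℝ] H) {P P' : ℝ → F} {p q : ℝ → G}
    (hP : ∀ x, HasDerivAt P (P' x) x) (hP' : Continuous P')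
    (hq : ∀ a b, IntervalIntegrable q volume a b) (hpq : ∀ a b, p b - p a = ∫ t in a..b, q t)
    (a b : ℝ) :
    B (P b) (p b) - B (P a) (p a) = ∫ t in a..b, (B (P' t) (p t) + B (P t) (q t)) := by
  have hPc : Continuous P := continuous_iff_continuousAt.2 fun x => (hP x).continuousAt
  have hpc := continuous_of_sub_eq_integral hq hpq
  have hc1 : Continuous fun t => B (P' t) (p t) := by fun_prop
  have hi1 : ∀ a b, IntervalIntegrable (fun t => B (P' t) (p t)) volume a b :=
    fun a b => hc1.intervalIntegrable a b
  have hi2 : ∀ a b, IntervalIntegrable (fun t => B (P t) (q t)) volume a b :=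
    fun a b => intervalIntegrable_bilin B hPc (hq a b)
  -- Neither term of `D` need be differentiable everywhere, but the difference has derivative zero
  -- at every point, so no almost-everywhere calculus is needed.
  set D : ℝ → H := fun y => B (P y) (p y) - ∫ t in a..y, (B (P' t) (p t) + B (P t) (q t)) with hD
  have hcompl : ∀ x y, B (P x) (p y - p x) = ∫ t in x..y, B (P x) (q t) := by
    intro x y
    rw [hpq]
    exact ((B (P x)).intervalIntegral_comp_comm (hq x y)).symm
  have hder : ∀ x, HasDerivAt D 0 x := by
    intro x
    -- Freeze `P` at `P x`: the frozen parts of the product and of the integral cancel exactly by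
    -- `hcompl`. What is left has derivatives `e1`, `e2` and `e3`, and `e1` needs only continuity of
    -- `p`.
    have e1 : HasDerivAt (fun y => B (P y - P x) (p y)) (B (P' x) (p x)) x := by
      have h := (hP x).tendsto_slope
      rw [hasDerivAt_iff_tendsto_slope]
      have h' : Tendsto (fun y => B (slope P x y) (p y)) (𝓝[≠] x) (𝓝 (B (P' x) (p x))) := by
        have hpx : Tendsto p (𝓝[≠] x) (𝓝 (p x)) := (hpc.tendsto x).mono_left nhdsWithin_le_nhds
        have hB : Continuous fun r : F × G => B r.1 r.2 := by fun_prop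
        exact (hB.tendsto (P' x, p x)).comp (h.prodMk_nhds hpx)
      refine h'.congr fun y => ?_
      simp [slope_def_module]
    have e2 : HasDerivAt (fun y => ∫ t in a..y, B (P' t) (p t)) (B (P' x) (p x)) x :=
      integral_hasDerivAt_right (hi1 a x) hc1.aestronglyMeasurable.stronglyMeasurableAtFilter
        hc1.continuousAt
    have e3 := hasDerivAt_integral_bilin_sub B (hP x) hq
    have e4 := ((e1.sub e2).sub e3).const_add (B (P x) (p x) - ∫ t in a..x, B (P t) (q t))
    rw [sub_self, sub_zero] at e4
    refine e4.congr_of_eventuallyEq (Eventually.of_forall fun y => ?_)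
    have e5 : ∫ t in x..y, B (P t - P x) (q t) = (∫ t in x..y, B (P t) (q t)) - B (P x) (p y - p x) := by
      rw [hcompl, ← intervalIntegral.integral_sub (hi2 x y)
        (intervalIntegrable_bilin B continuous_const (hq x y))]
      simp
    have e6 := integral_add_adjacent_intervals (hi2 a x) (hi2 x y)
    simp only [hD, Pi.sub_apply]
    rw [e5, intervalIntegral.integral_add (hi1 a y) (hi2 a y), ← e6]
    simp only [map_sub, sub_apply]
    abel
  have hconst := is_const_of_deriv_eq_zero (fun x => (hder x).differentiableAt)
    (fun x => (hder x).deriv) b a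
  simp only [hD, intervalIntegral.integral_same, sub_zero] at hconst
  rw [← hconst]; abel

end Bilinear

/-! ### Decay at infinity from local L² bounds -/

section Decay

variable {X : Type*} [NormedAddCommGroup X] [NormedSpace ℝ X]

/-- On a unit interval, a function satisfying a second order differential inequality with
integrable coefficients is controlled, together with its derivative, by its `L²` norm. -/
lemma norm_le_of_second_order {w w' : ℝ → X} {k h : ℝ → ℝ} {a K : ℝ}
    (hw : ∀ x, HasDerivAt w (w' x) x) (hk : IntervalIntegrable k volume a (a + 1))
    (hh : IntervalIntegrable h volume a (a + 1)) (hk0 : ∀ x, 0 ≤ k x) (hh0 : ∀ x, 0 ≤ h x)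
    (hK : ∫ t in a..(a + 1), k t ≤ K)
    (hbd : ∀ x y, x ≤ y → ‖w' y - w' x‖ ≤ ∫ t in x..y, (k t * ‖w t‖ + h t))
    {M : ℝ} (hM : M = √((8 * (∫ t in a..(a + 1), ‖w t‖ ^ 2) + 8 * (∫ t in a..(a + 1), h t) ^ 2)
      * (10 + 2 * K))) :
    ‖w a‖ ≤ M ∧ ‖w' a‖ ≤ (4 + K) * M + ∫ t in a..(a + 1), h t := by
  have hwc : Continuous w := continuous_iff_continuousAt.2 fun x => (hw x).continuousAt
  have ha1 : a ≤ a + 1 := by linarith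
  set S := ∫ t in a..(a + 1), ‖w t‖ ^ 2 with hS
  set J := ∫ t in a..(a + 1), h t with hJ
  have hK0 : 0 ≤ K := (integral_nonneg ha1 fun t _ => hk0 t).trans hK
  have hJ0 : 0 ≤ J := integral_nonneg ha1 fun t _ => hh0 t
  have hS0 : 0 ≤ S := integral_nonneg ha1 fun t _ => by positivity
  obtain ⟨x₀, hx₀, hmax⟩ := (isCompact_Icc (a := a) (b := a + 1)).exists_isMaxOn
    ⟨a, left_mem_Icc.2 ha1⟩ hwc.norm.continuousOn
  set m := ‖w x₀‖ with hm
  have hm0 : 0 ≤ m := norm_nonneg _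
  have hle : ∀ t ∈ Icc a (a + 1), ‖w t‖ ≤ m := fun t ht => hmax ht
  have hosc1 : ∀ x ∈ Icc a (a + 1), ∀ y ∈ Icc a (a + 1), x ≤ y → ‖w' y - w' x‖ ≤ K * m + J := by
    intro x hx y hy hxy
    have hkw : IntervalIntegrable (fun t => k t * m + h t) volume a (a + 1) :=
      (hk.mul_const m).add hh
    have hkw' : IntervalIntegrable (fun t => k t * ‖w t‖ + h t) volume a (a + 1) :=
      (hk.mul_continuousOn hwc.norm.continuousOn).add hh
    have hsub : [[x, y]] ⊆ [[a, a + 1]] := by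
      rw [uIcc_of_le hxy, uIcc_of_le ha1]; exact Icc_subset_Icc hx.1 hy.2
    calc ‖w' y - w' x‖ ≤ ∫ t in x..y, (k t * ‖w t‖ + h t) := hbd x y hxy
      _ ≤ ∫ t in x..y, (k t * m + h t) := by
          refine integral_mono_on hxy (hkw'.mono_set hsub) (hkw.mono_set hsub) fun t ht => ?_
          have := hle t ⟨hx.1.trans ht.1, ht.2.trans hy.2⟩
          have := hk0 t
          gcongr
      _ ≤ ∫ t in a..(a + 1), (k t * m + h t) := by
          refine integral_mono_interval hx.1 hxy hy.2 (Eventually.of_forall fun t => ?_) hkw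
          have := hk0 t
          have := hh0 t
          simp only [Pi.zero_apply]
          positivity
      _ = (∫ t in a..(a + 1), k t) * m + J := by
          rw [intervalIntegral.integral_add (hk.mul_const m) hh, intervalIntegral.integral_mul_const]
      _ ≤ K * m + J := by gcongr
  have hosc : ∀ x ∈ Icc a (a + 1), ∀ y ∈ Icc a (a + 1), ‖w' y - w' x‖ ≤ K * m + J := by
    intro x hx y hy
    rcases le_total x y with hxy | hxy
    · exact hosc1 x hx y hy hxy
    · rw [norm_sub_rev]; exact hosc1 y hy x hx hxy
  have htaylor : ∀ x ∈ Icc a (a + 1), ∀ y ∈ Icc a (a + 1),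
      ‖w y - w x - (y - x) • w' x‖ ≤ (K * m + J) * |y - x| := by
    intro x hx y hy
    have hd : ∀ t ∈ Icc a (a + 1), HasDerivWithinAt (fun t => w t - (t - x) • w' x)
        (w' t - w' x) (Icc a (a + 1)) t := by
      intro t _
      have h1 : HasDerivAt (fun t : ℝ => (t - x) • w' x) ((1 : ℝ) • w' x) t :=
        ((hasDerivAt_id t).sub_const x).smul_const (w' x)
      rw [one_smul] at h1
      exact ((hw t).sub h1).hasDerivWithinAt
    have h2 := (convex_Icc a (a + 1)).norm_image_sub_le_of_norm_hasDerivWithin_le hd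
      (fun t ht => hosc x hx t ht) hx hy
    simp only [sub_self, zero_smul, sub_zero, Real.norm_eq_abs] at h2
    convert h2 using 2
    abel
  have hw'le : ∀ x ∈ Icc a (a + 1), ‖w' x‖ ≤ (4 + K) * m + J := by
    intro x hx
    -- Some point at distance `1/2` always stays in the unit interval; Taylor's estimate there gives
    -- `‖w' x‖ / 2 ≤ 2 * m + (K * m + J) / 2`.
    obtain ⟨y, hy, hxy⟩ : ∃ y ∈ Icc a (a + 1), |y - x| = 1 / 2 := by
      rcases le_total x (a + 1 / 2) with hxa | hxa
      · exact ⟨x + 1 / 2, ⟨by linarith [hx.1], by linarith⟩, by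
          rw [add_sub_cancel_left, abs_of_pos (by norm_num)]⟩
      · exact ⟨x - 1 / 2, ⟨by linarith, by linarith [hx.2]⟩, by
          rw [sub_sub_cancel_left, abs_neg, abs_of_pos (by norm_num)]⟩
    have h1 := htaylor x hx y hy
    have h2 : ‖(y - x) • w' x‖ ≤ ‖w y‖ + ‖w x‖ + (K * m + J) * |y - x| := by
      have e : (y - x) • w' x = w y - w x - (w y - w x - (y - x) • w' x) := by abel
      rw [e]
      exact (norm_sub_le _ _).trans (add_le_add (norm_sub_le _ _) h1)
    rw [norm_smul, Real.norm_eq_abs, hxy] at h2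
    linarith [hle x hx, hle y hy]
  -- Chosen so that `(4 + K) * δ ≤ 1 / 2`: within distance `δ` of the maximum point, `‖w‖` drops by
  -- at most `m / 2 + J`. Also `δ ≤ 1 / 2`, so an interval of length `δ` with endpoint `x₀` fits in
  -- `[a, a + 1]`.
  set δ : ℝ := 1 / (10 + 2 * K) with hδ
  have hδ0 : 0 < δ := by positivity
  have hδm : δ * (10 + 2 * K) = 1 := by rw [hδ]; field_simp
  have hδ1 : δ ≤ 1 / 2 := by nlinarith
  obtain ⟨c, hc1, hc2, hc3⟩ : ∃ c, a ≤ c ∧ c + δ ≤ a + 1 ∧ ∀ y ∈ Icc c (c + δ), |y - x₀| ≤ δ := by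
    rcases le_total x₀ (a + 1 / 2) with hxa | hxa
    · exact ⟨x₀, hx₀.1, by linarith, fun y hy => abs_le.2 ⟨by linarith [hy.1], by linarith [hy.2]⟩⟩
    · exact ⟨x₀ - δ, by linarith, by linarith [hx₀.2],
        fun y hy => abs_le.2 ⟨by linarith [hy.1], by linarith [hy.2]⟩⟩
  have hlow : ∀ y ∈ Icc c (c + δ), m ^ 2 ≤ 8 * ‖w y‖ ^ 2 + 8 * J ^ 2 := by
    intro y hy
    have hyI : y ∈ Icc a (a + 1) := ⟨hc1.trans hy.1, hy.2.trans hc2⟩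
    have h1 := (convex_Icc a (a + 1)).norm_image_sub_le_of_norm_hasDerivWithin_le
      (fun t _ => (hw t).hasDerivWithinAt) hw'le hyI hx₀
    have h2 : m ≤ ‖w y‖ + ‖w x₀ - w y‖ := by
      have := norm_add_le (w y) (w x₀ - w y)
      rwa [add_sub_cancel] at this
    have h3 : ‖x₀ - y‖ ≤ δ := by rw [Real.norm_eq_abs, abs_sub_comm]; exact hc3 y hy
    have h4 : ((4 + K) * m + J) * ‖x₀ - y‖ ≤ ((4 + K) * m + J) * δ := by gcongr
    have h5 : ((4 + K) * m + J) * δ ≤ m / 2 + J := by nlinarith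
    have h6 : m ≤ 2 * ‖w y‖ + 2 * J := by linarith
    nlinarith [sq_nonneg (‖w y‖ - J), norm_nonneg (w y)]
  have hwi : ∀ b d, IntervalIntegrable (fun t => ‖w t‖ ^ 2) volume b d :=
    fun b d => (hwc.norm.pow 2).intervalIntegrable b d
  have hint : δ * m ^ 2 ≤ 8 * S + 8 * J ^ 2 := by
    have hcd : c ≤ c + δ := by linarith
    have h1 : ∫ t in c..(c + δ), m ^ 2 ≤ ∫ t in c..(c + δ), (8 * ‖w t‖ ^ 2 + 8 * J ^ 2) :=
      integral_mono_on hcd intervalIntegrable_const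
        (((hwi _ _).const_mul 8).add intervalIntegrable_const) hlow
    rw [intervalIntegral.integral_add ((hwi _ _).const_mul 8) intervalIntegrable_const,
      intervalIntegral.integral_const_mul, intervalIntegral.integral_const,
      intervalIntegral.integral_const] at h1
    simp only [add_sub_cancel_left, smul_eq_mul] at h1
    have h2 : ∫ t in c..(c + δ), ‖w t‖ ^ 2 ≤ S :=
      integral_mono_interval hc1 hcd hc2 (Eventually.of_forall fun t => by positivity) (hwi _ _)
    nlinarith [sq_nonneg J]
  have hmM : m ≤ M := by
    rw [hM]
    refine Real.le_sqrt_of_sq_le ?_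
    calc m ^ 2 = δ * m ^ 2 * (10 + 2 * K) := by rw [mul_right_comm, hδm, one_mul]
      _ ≤ _ := by gcongr
  have haI : a ∈ Icc a (a + 1) := left_mem_Icc.2 ha1
  refine ⟨(hle a haI).trans hmM, (hw'le a haI).trans ?_⟩
  gcongr

lemma tendsto_zero_of_second_order {w w' : ℝ → X} {k h : ℝ → ℝ} {K : ℝ} {l : Filter ℝ}
    (hw : ∀ x, HasDerivAt w (w' x) x) (hk : ∀ a b, IntervalIntegrable k volume a b)
    (hh : ∀ a b, IntervalIntegrable h volume a b) (hk0 : ∀ x, 0 ≤ k x) (hh0 : ∀ x, 0 ≤ h x)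
    (hK : ∀ a, ∫ t in a..(a + 1), k t ≤ K)
    (hbd : ∀ x y, x ≤ y → ‖w' y - w' x‖ ≤ ∫ t in x..y, (k t * ‖w t‖ + h t))
    (hS : Tendsto (fun a => ∫ t in a..(a + 1), ‖w t‖ ^ 2) l (𝓝 0))
    (hH : Tendsto (fun a => ∫ t in a..(a + 1), h t) l (𝓝 0)) :
    Tendsto w l (𝓝 0) ∧ Tendsto w' l (𝓝 0) := by
  set M : ℝ → ℝ := fun a => √((8 * (∫ t in a..(a + 1), ‖w t‖ ^ 2)
    + 8 * (∫ t in a..(a + 1), h t) ^ 2) * (10 + 2 * K)) with hM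
  have hb := fun a => norm_le_of_second_order hw (hk a (a + 1)) (hh a (a + 1)) hk0 hh0 (hK a) hbd
    (M := M a) rfl
  have hM0 : Tendsto M l (𝓝 0) := by
    have h1 := (((hS.const_mul 8).add ((hH.pow 2).const_mul 8)).mul_const (10 + 2 * K)).sqrt
    simpa using h1
  refine ⟨squeeze_zero_norm (fun a => (hb a).1) hM0, squeeze_zero_norm (fun a => (hb a).2) ?_⟩
  simpa using (hM0.const_mul (4 + K)).add hH

/-- The unit integral is the difference of two integrals from `c` that converge to the same limit.
-/
lemma tendsto_integral_unit_atTop {g : ℝ → ℝ} (hg : ∀ a b, IntervalIntegrable g volume a b)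
    {c : ℝ} (hgi : IntegrableOn g (Ioi c)) :
    Tendsto (fun a => ∫ t in a..(a + 1), g t) atTop (𝓝 0) := by
  have h1 := intervalIntegral_tendsto_integral_Ioi c hgi tendsto_id
  have h2 := h1.comp (tendsto_atTop_add_const_right atTop (1 : ℝ) tendsto_id)
  have h3 := h2.sub h1
  rw [sub_self] at h3
  refine h3.congr fun a => ?_
  exact integral_interval_sub_left (hg _ _) (hg _ _)

lemma tendsto_integral_unit_atBot {g : ℝ → ℝ} (hg : ∀ a b, IntervalIntegrable g volume a b)
    {c : ℝ} (hgi : IntegrableOn g (Iic c)) :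
    Tendsto (fun a => ∫ t in a..(a + 1), g t) atBot (𝓝 0) := by
  have h1 := intervalIntegral_tendsto_integral_Iic c hgi tendsto_id
  have h2 := h1.comp (tendsto_atBot_add_const_right atBot (1 : ℝ) tendsto_id)
  have h3 := h1.sub h2
  rw [sub_self] at h3
  refine h3.congr fun a => ?_
  exact sub_eq_of_eq_add (integral_add_adjacent_intervals (hg a (a + 1)) (hg (a + 1) c)).symm

/-- Cauchy–Schwarz on an interval of length one, from expanding `∫ (g - J) ^ 2 ≥ 0`. -/
lemma sq_integral_unit_le {g : ℝ → ℝ} {a : ℝ} (hg : IntervalIntegrable g volume a (a + 1))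
    (hg2 : IntervalIntegrable (fun t => g t ^ 2) volume a (a + 1)) :
    (∫ t in a..(a + 1), g t) ^ 2 ≤ ∫ t in a..(a + 1), g t ^ 2 := by
  set J := ∫ t in a..(a + 1), g t with hJ
  have h1 : 0 ≤ ∫ t in a..(a + 1), (g t ^ 2 - 2 * J * g t + J ^ 2) :=
    integral_nonneg (by linarith) fun t _ => by nlinarith [sq_nonneg (g t - J)]
  rw [intervalIntegral.integral_add (hg2.sub (hg.const_mul _)) intervalIntegrable_const,
    intervalIntegral.integral_sub hg2 (hg.const_mul _), intervalIntegral.integral_const_mul,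
    intervalIntegral.integral_const, ← hJ] at h1
  simp only [add_sub_cancel_left, one_smul] at h1
  nlinarith

end Decay

/-! ### Lagrange's identity and boundary terms for operator coefficients -/

section Abstract

variable {E : Type*} [NormedAddCommGroup E] [NormedSpace ℝ E]

/-- `u'' = Q u - f` in integrated form, with `u'` the derivative of `u`. -/
structure SolvesODE (Q : ℝ → E →L[ℝ] E) (f u u' : ℝ → E) : Prop where
  hasDerivAt : ∀ x, HasDerivAt u (u' x) x
  integrated : ∀ a b : ℝ, u' b - u' a = ∫ t in a..b, (Q t (u t) - f t)

/-- `Φ'' = Φ Q` in integrated form, with `Φ'` the derivative of `Φ`. -/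
structure SolvesAdjointODE (Q Φ Φ' : ℝ → E →L[ℝ] E) : Prop where
  hasDerivAt : ∀ x, HasDerivAt Φ (Φ' x) x
  integrated : ∀ a b : ℝ, Φ' b - Φ' a = ∫ t in a..b, Φ t ∘L Q t

variable {Q Φ Φ' : ℝ → E →L[ℝ] E} {f u u' : ℝ → E} {K : ℝ} {l : Filter ℝ}

lemma SolvesODE.continuous (hu : SolvesODE Q f u u') : Continuous u :=
  continuous_iff_continuousAt.2 fun x => (hu.hasDerivAt x).continuousAt

lemma SolvesAdjointODE.continuous (hΦ : SolvesAdjointODE Q Φ Φ') : Continuous Φ :=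
  continuous_iff_continuousAt.2 fun x => (hΦ.hasDerivAt x).continuousAt

lemma SolvesODE.intervalIntegrable (hu : SolvesODE Q f u u')
    (hQ : ∀ a b, IntervalIntegrable Q volume a b) (a b : ℝ) :
    IntervalIntegrable (fun t => Q t (u t)) volume a b :=
  intervalIntegrable_bilin (ContinuousLinearMap.id ℝ (E →L[ℝ] E)).flip hu.continuous (hQ a b)

lemma SolvesAdjointODE.intervalIntegrable (hΦ : SolvesAdjointODE Q Φ Φ')
    (hQ : ∀ a b, IntervalIntegrable Q volume a b) (a b : ℝ) :
    IntervalIntegrable (fun t => Φ t ∘L Q t) volume a b :=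
  intervalIntegrable_bilin (ContinuousLinearMap.compL ℝ E E E) hΦ.continuous (hQ a b)

lemma intervalIntegrable_comp {Ψ : ℝ → E →L[ℝ] E} (hΨ : Continuous Ψ) {a b : ℝ}
    (hQ : IntervalIntegrable Q volume a b) :
    IntervalIntegrable (fun t => Q t ∘L Ψ t) volume a b :=
  intervalIntegrable_bilin (ContinuousLinearMap.compL ℝ E E E).flip hΨ hQ

lemma SolvesODE.tendsto_zero (hu : SolvesODE Q f u u')
    (hQ : ∀ a b, IntervalIntegrable Q volume a b) (hK : ∀ a, ∫ t in a..(a + 1), ‖Q t‖ ≤ K)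
    (hf : ∀ a b, IntervalIntegrable f volume a b)
    (hS : Tendsto (fun a => ∫ t in a..(a + 1), ‖u t‖ ^ 2) l (𝓝 0))
    (hH : Tendsto (fun a => ∫ t in a..(a + 1), ‖f t‖) l (𝓝 0)) :
    Tendsto u l (𝓝 0) ∧ Tendsto u' l (𝓝 0) := by
  refine tendsto_zero_of_second_order hu.hasDerivAt (fun a b => (hQ a b).norm)
    (fun a b => (hf a b).norm) (fun _ => norm_nonneg _) (fun _ => norm_nonneg _) hK
    (fun x y hxy => ?_) hS hH
  rw [hu.integrated]
  refine norm_integral_le_of_norm_le hxy (Eventually.of_forall fun t _ => ?_)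
    (((hQ x y).norm.mul_continuousOn hu.continuous.norm.continuousOn).add (hf x y).norm)
  exact (norm_sub_le _ _).trans (by gcongr; exact (Q t).le_opNorm _)

lemma SolvesAdjointODE.tendsto_zero (hΦ : SolvesAdjointODE Q Φ Φ')
    (hQ : ∀ a b, IntervalIntegrable Q volume a b) (hK : ∀ a, ∫ t in a..(a + 1), ‖Q t‖ ≤ K)
    (hS : Tendsto (fun a => ∫ t in a..(a + 1), ‖Φ t‖ ^ 2) l (𝓝 0)) :
    Tendsto Φ l (𝓝 0) ∧ Tendsto Φ' l (𝓝 0) := by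
  refine tendsto_zero_of_second_order (h := 0) hΦ.hasDerivAt (fun a b => (hQ a b).norm)
    (fun a b => intervalIntegrable_const) (fun _ => norm_nonneg _) (fun _ => le_rfl) hK
    (fun x y hxy => ?_) hS (by simpa using tendsto_const_nhds)
  rw [hΦ.integrated]
  refine norm_integral_le_of_norm_le hxy (Eventually.of_forall fun t _ => ?_)
    (((hQ x y).norm.mul_continuousOn hΦ.continuous.norm.continuousOn).add intervalIntegrable_const)
  simpa [mul_comm] using (Φ t).opNorm_comp_le (Q t)

/-- Lagrange's identity. -/
lemma wronskian_sub_eq_integral [CompleteSpace E] (hΦ : SolvesAdjointODE Q Φ Φ')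
    (hu : SolvesODE Q f u u') (hQ : ∀ a b, IntervalIntegrable Q volume a b)
    (hf : ∀ a b, IntervalIntegrable f volume a b) (a b : ℝ) :
    (Φ b (u' b) - Φ' b (u b)) - (Φ a (u' a) - Φ' a (u a)) = -∫ t in a..b, Φ t (f t) := by
  set B := ContinuousLinearMap.id ℝ (E →L[ℝ] E) with hB
  have hQu := hu.intervalIntegrable hQ
  have hΦQ := hΦ.intervalIntegrable hQ
  have hΦ'c := continuous_of_sub_eq_integral hΦQ hΦ.integrated
  have hu'c := continuous_of_sub_eq_integral (fun a b => (hQu a b).sub (hf a b)) hu.integrated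
  have h1 := bilin_sub_eq_integral B hΦ.hasDerivAt hΦ'c (fun a b => (hQu a b).sub (hf a b))
    hu.integrated a b
  have h2 := bilin_sub_eq_integral B.flip hu.hasDerivAt hu'c hΦQ hΦ.integrated a b
  simp only [hB, ContinuousLinearMap.flip_apply, ContinuousLinearMap.coe_id', id_eq,
    ContinuousLinearMap.comp_apply] at h1 h2
  have i1 : IntervalIntegrable (fun t => Φ' t (u' t)) volume a b :=
    (hΦ'c.clm_apply hu'c).intervalIntegrable a b
  have i2 : IntervalIntegrable (fun t => Φ t (Q t (u t))) volume a b :=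
    intervalIntegrable_bilin B hΦ.continuous (hQu a b)
  have i3 : IntervalIntegrable (fun t => Φ t (f t)) volume a b :=
    intervalIntegrable_bilin B hΦ.continuous (hf a b)
  have e : ∫ t in a..b, (Φ' t (u' t) + Φ t (Q t (u t) - f t))
      = (∫ t in a..b, (Φ' t (u' t) + Φ t (Q t (u t)))) - ∫ t in a..b, Φ t (f t) := by
    rw [← intervalIntegral.integral_sub (i1.add i2) i3]
    congr 1 with t
    rw [map_sub]; abel
  rw [e, ← h2] at h1
  have : (Φ b (u' b) - Φ' b (u b)) - (Φ a (u' a) - Φ' a (u a))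
      = (Φ b (u' b) - Φ a (u' a)) - (Φ' b (u b) - Φ' a (u a)) := by abel
  rw [this, h1]; abel

lemma tendsto_wronskian_zero (h1 : Tendsto Φ l (𝓝 0)) (h2 : Tendsto Φ' l (𝓝 0))
    (h3 : Tendsto u l (𝓝 0)) (h4 : Tendsto u' l (𝓝 0)) :
    Tendsto (fun x => Φ x (u' x) - Φ' x (u x)) l (𝓝 0) := by
  have hB : Continuous fun r : (E →L[ℝ] E) × E => r.1 r.2 := by fun_prop
  have e1 := (hB.tendsto (0, 0)).comp (h1.prodMk_nhds h4)
  have e2 := (hB.tendsto (0, 0)).comp (h2.prodMk_nhds h3)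
  simpa using e1.sub e2

/-- Lagrange's identity on `[a, x]` as `a → -∞`, where the boundary term at `a` disappears. -/
lemma wronskian_eq_integral_Iic [CompleteSpace E] (hΦ : SolvesAdjointODE Q Φ Φ')
    (hu : SolvesODE Q f u u') (hQ : ∀ a b, IntervalIntegrable Q volume a b)
    (hf : ∀ a b, IntervalIntegrable f volume a b)
    (hW : Tendsto (fun x => Φ x (u' x) - Φ' x (u x)) atBot (𝓝 0)) {x : ℝ}
    (hi : IntegrableOn (fun t => Φ t (f t)) (Iic x)) :
    Φ x (u' x) - Φ' x (u x) = -∫ t in Iic x, Φ t (f t) := by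
  have h1 := (intervalIntegral_tendsto_integral_Iic x hi tendsto_id).neg
  have h2 := (tendsto_const_nhds (x := Φ x (u' x) - Φ' x (u x))).sub hW
  rw [sub_zero] at h2
  exact tendsto_nhds_unique (h2.congr fun a => wronskian_sub_eq_integral hΦ hu hQ hf a x) h1

lemma wronskian_eq_integral_Ioi [CompleteSpace E] (hΦ : SolvesAdjointODE Q Φ Φ')
    (hu : SolvesODE Q f u u') (hQ : ∀ a b, IntervalIntegrable Q volume a b)
    (hf : ∀ a b, IntervalIntegrable f volume a b)
    (hW : Tendsto (fun x => Φ x (u' x) - Φ' x (u x)) atTop (𝓝 0)) {x : ℝ}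
    (hi : IntegrableOn (fun t => Φ t (f t)) (Ioi x)) :
    Φ x (u' x) - Φ' x (u x) = ∫ t in Ioi x, Φ t (f t) := by
  have h1 := (intervalIntegral_tendsto_integral_Ioi x hi tendsto_id).neg
  have h2 := hW.sub (tendsto_const_nhds (x := Φ x (u' x) - Φ' x (u x)))
  rw [zero_sub] at h2
  exact neg_injective
    (tendsto_nhds_unique (h2.congr fun b => wronskian_sub_eq_integral hΦ hu hQ hf x b) h1)

/-- The Wronskian of homogeneous solutions vanishes if it tends to zero at one end. -/
lemma wronskian_eq_zero_of_tendsto [CompleteSpace E] [l.NeBot] (hΦ : SolvesAdjointODE Q Φ Φ')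
    (hu : SolvesODE Q 0 u u') (hQ : ∀ a b, IntervalIntegrable Q volume a b)
    (hW : Tendsto (fun x => Φ x (u' x) - Φ' x (u x)) l (𝓝 0)) (x : ℝ) :
    Φ x (u' x) - Φ' x (u x) = 0 := by
  refine tendsto_nhds_unique (tendsto_const_nhds.congr fun a => ?_) hW
  have h := wronskian_sub_eq_integral hΦ hu hQ (fun _ _ => intervalIntegrable_const) x a
  exact (sub_eq_zero.1 (by simpa using h)).symm

/-- Hölder: the product of two L² norms dominates the integrand. -/
lemma integrableOn_apply {s : Set ℝ} (hΦ : Continuous Φ)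
    (hΦ2 : IntegrableOn (fun t => ‖Φ t‖ ^ 2) s) (hf : MemLp f 2 volume) :
    IntegrableOn (fun t => Φ t (f t)) s := by
  have h1 : MemLp Φ 2 (volume.restrict s) :=
    (memLp_two_iff_integrable_sq_norm hΦ.aestronglyMeasurable).2 hΦ2
  have h2 := hf.restrict s
  refine (h1.norm.integrable_mul h2.norm).mono'
    ((ContinuousLinearMap.id ℝ (E →L[ℝ] E)).aestronglyMeasurable_comp₂ h1.1 h2.1)
    (Eventually.of_forall fun t => (Φ t).le_opNorm _)

lemma integrableOn_Iic_of_Iio {g : ℝ → ℝ} (hg : Continuous g) (h : IntegrableOn g (Iio 0)) (x : ℝ) :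
    IntegrableOn g (Iic x) :=
  (h.union (hg.integrableOn_Icc (a := 0) (b := x))).mono_set fun t ht =>
    (lt_or_ge t 0).imp id fun h0 => ⟨h0, ht⟩

lemma integrableOn_Ioi_of_Ioi {g : ℝ → ℝ} (hg : Continuous g) (h : IntegrableOn g (Ioi 0)) (x : ℝ) :
    IntegrableOn g (Ioi x) :=
  (h.union (hg.integrableOn_Icc (a := x) (b := 0))).mono_set fun t ht =>
    (lt_or_ge 0 t).imp id fun h0 => ⟨le_of_lt ht, h0⟩

/-- Square integrable solutions with a square integrable right hand side vanish, together with
their derivatives, at both ends of the line. -/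
lemma SolvesODE.tendsto_zero_of_memLp (hu : SolvesODE Q f u u')
    (hQ : ∀ a b, IntervalIntegrable Q volume a b) (hK : ∀ a, ∫ t in a..(a + 1), ‖Q t‖ ≤ K)
    (hf : MemLp f 2 volume) (hu2 : MemLp u 2 volume) :
    (Tendsto u atTop (𝓝 0) ∧ Tendsto u' atTop (𝓝 0)) ∧
      (Tendsto u atBot (𝓝 0) ∧ Tendsto u' atBot (𝓝 0)) := by
  have hfi : ∀ a b, IntervalIntegrable f volume a b := fun a b =>
    ((hf.locallyIntegrable (by norm_num)).integrableOn_isCompact isCompact_uIcc).intervalIntegrable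
  have hf2 : Integrable (fun t => ‖f t‖ ^ 2) := (memLp_two_iff_integrable_sq_norm hf.1).1 hf
  have hu2' : Integrable (fun t => ‖u t‖ ^ 2) := (memLp_two_iff_integrable_sq_norm hu2.1).1 hu2
  have hH : ∀ l : Filter ℝ, Tendsto (fun a => ∫ t in a..(a + 1), ‖f t‖ ^ 2) l (𝓝 0) →
      Tendsto (fun a => ∫ t in a..(a + 1), ‖f t‖) l (𝓝 0) := by
    intro l h
    have h' := h.sqrt
    rw [Real.sqrt_zero] at h'
    refine squeeze_zero (fun a => integral_nonneg (by linarith) fun t _ => norm_nonneg _)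
      (fun a => Real.le_sqrt_of_sq_le ?_) h'
    exact sq_integral_unit_le (hfi _ _).norm hf2.intervalIntegrable
  constructor
  · exact hu.tendsto_zero hQ hK hfi
      (tendsto_integral_unit_atTop (c := 0) (fun _ _ => hu2'.intervalIntegrable) hu2'.integrableOn)
      (hH _ (tendsto_integral_unit_atTop (c := 0) (fun _ _ => hf2.intervalIntegrable)
        hf2.integrableOn))
  · exact hu.tendsto_zero hQ hK hfi
      (tendsto_integral_unit_atBot (c := 0) (fun _ _ => hu2'.intervalIntegrable) hu2'.integrableOn)
      (hH _ (tendsto_integral_unit_atBot (c := 0) (fun _ _ => hf2.intervalIntegrable)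
        hf2.integrableOn))

end Abstract

/-! ### From matrix entries to operators on `ℂⁿ` -/

section Matrix

variable {n : ℕ}

/-- The real-linear action of complex matrices on `ℂⁿ`, on matrices as functions of two indices. -/
noncomputable def matrixOp (n : ℕ) :
    (Fin n → Fin n → ℂ) →L[ℝ] (EuclideanSpace ℂ (Fin n) →L[ℝ] EuclideanSpace ℂ (Fin n)) :=
  LinearMap.toContinuousLinearMap
    { toFun := fun M => (Matrix.toEuclideanCLM (𝕜 := ℂ) (Matrix.of M)).restrictScalars ℝ
      map_add' := fun M N => by
        rw [← Matrix.of_add_of, map_add]; rfl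
      map_smul' := fun c M => by
        ext v i
        simp [Matrix.mulVec, dotProduct, Finset.mul_sum, mul_assoc] }

lemma matrixOp_apply (M : Matrix (Fin n) (Fin n) ℂ) (v : EuclideanSpace ℂ (Fin n)) :
    matrixOp n M v = Matrix.toEuclideanCLM (𝕜 := ℂ) M v := rfl

lemma matrixOp_mul (M N : Matrix (Fin n) (Fin n) ℂ) :
    matrixOp n (M * N) = matrixOp n M ∘L matrixOp n N := by
  ext1 v
  simp only [ContinuousLinearMap.comp_apply, matrixOp_apply, map_mul]
  rfl

lemma matrixOp_injective : Function.Injective (matrixOp n) := by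
  intro M N h
  refine Matrix.of.injective ((Matrix.toEuclideanCLM (𝕜 := ℂ) (n := Fin n)).injective ?_)
  ext1 v
  exact DFunLike.congr_fun h v

lemma hasDerivAt_matrixOp {ψ : ℝ → Matrix (Fin n) (Fin n) ℂ}
    (h : ∀ i j, Differentiable ℝ fun x => ψ x i j) (x : ℝ) :
    HasDerivAt (fun x => matrixOp n (ψ x)) (matrixOp n (mderiv ψ x)) x := by
  refine HasFDerivAt.comp_hasDerivAt (f := fun x i j => ψ x i j) x (matrixOp n).hasFDerivAt ?_
  exact hasDerivAt_pi.2 fun i => hasDerivAt_pi.2 fun j => (h i j x).hasDerivAt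

lemma intervalIntegrable_matrix {r : ℝ → Matrix (Fin n) (Fin n) ℂ} {a b : ℝ}
    (h : ∀ i j, IntervalIntegrable (fun x => r x i j) volume a b) :
    IntervalIntegrable (fun x i j => r x i j) volume a b := by
  rw [intervalIntegrable_iff]
  exact Integrable.of_eval fun i => Integrable.of_eval fun j => intervalIntegrable_iff.1 (h i j)

lemma matrixOp_eq_integral {r : ℝ → Matrix (Fin n) (Fin n) ℂ} {N : Matrix (Fin n) (Fin n) ℂ}
    {a b : ℝ} (h : ∀ i j, IntervalIntegrable (fun x => r x i j) volume a b)
    (hN : ∀ i j, N i j = ∫ x in a..b, r x i j) :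
    matrixOp n N = ∫ x in a..b, matrixOp n (r x) := by
  have h1 := intervalIntegrable_matrix h
  refine Eq.trans ?_ ((matrixOp n).intervalIntegral_comp_comm h1).symm
  refine congrArg (matrixOp n) (funext fun i => funext fun j => ?_)
  have e1 := (ContinuousLinearMap.proj (R := ℝ) (φ := fun _ : Fin n => Fin n → ℂ)
    i).intervalIntegral_comp_comm h1
  have h2 : IntervalIntegrable (fun x => r x i) volume a b := by
    rw [intervalIntegrable_iff]
    exact Integrable.of_eval fun j => intervalIntegrable_iff.1 (h i j)
  have e2 := (ContinuousLinearMap.proj (R := ℝ) (φ := fun _ : Fin n => ℂ)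
    j).intervalIntegral_comp_comm h2
  rw [hN]
  exact e2.trans (congrFun e1 j)

/-- The coefficient `V - z` of the equation `u'' = (V - z) u`. -/
noncomputable def coeffOp (V : ℝ → Matrix (Fin n) (Fin n) ℂ) (z : ℂ) (t : ℝ) :
    EuclideanSpace ℂ (Fin n) →L[ℝ] EuclideanSpace ℂ (Fin n) :=
  matrixOp n (V t - z • (1 : Matrix (Fin n) (Fin n) ℂ))

variable {V : ℝ → Matrix (Fin n) (Fin n) ℂ} {z : ℂ}

lemma IsPotential.intervalIntegrable (hV : IsPotential V) (i j : Fin n) (a b : ℝ) :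
    IntervalIntegrable (fun x => V x i j) volume a b :=
  ((hV.locallyIntegrable i j).integrableOn_isCompact isCompact_uIcc).intervalIntegrable

lemma intervalIntegrable_coeffOp (hV : IsPotential V) (a b : ℝ) :
    IntervalIntegrable (coeffOp V z) volume a b := by
  have h := intervalIntegrable_matrix (r := fun t => V t - z • (1 : Matrix (Fin n) (Fin n) ℂ))
    (a := a) (b := b) fun i j => by
      simpa using (hV.intervalIntegrable i j a b).sub intervalIntegrable_const
  rw [intervalIntegrable_iff] at h ⊢
  exact (matrixOp n).integrable_comp h

lemma exists_integral_norm_coeffOp_le (hV : IsPotential V) :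
    ∃ K : ℝ, ∀ a, ∫ t in a..(a + 1), ‖coeffOp V z t‖ ≤ K := by
  obtain ⟨C, hC⟩ := hV.uniform
  set D : ℝ := ‖matrixOp n ((z • (1 : Matrix (Fin n) (Fin n) ℂ) : Matrix (Fin n) (Fin n) ℂ))‖
    with hD
  refine ⟨‖matrixOp n‖ * (∑ _i : Fin n, ∑ _j : Fin n, C) + D, fun a => ?_⟩
  have hVi : ∀ i j, IntervalIntegrable (fun t => ‖V t i j‖) volume a (a + 1) :=
    fun i j => (hV.intervalIntegrable i j a (a + 1)).norm
  have hs : IntervalIntegrable (fun t => ∑ i, ∑ j, ‖V t i j‖) volume a (a + 1) := by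
    have := IntervalIntegrable.sum (μ := volume) (a := a) (b := a + 1) Finset.univ
      (f := fun i t => ∑ j, ‖V t i j‖) fun i _ => by
        have := IntervalIntegrable.sum (μ := volume) (a := a) (b := a + 1) Finset.univ
          (f := fun j t => ‖V t i j‖) fun j _ => hVi i j
        simpa [Finset.sum_fn] using this
    simpa [Finset.sum_fn] using this
  calc ∫ t in a..(a + 1), ‖coeffOp V z t‖
      ≤ ∫ t in a..(a + 1), (‖matrixOp n‖ * (∑ i, ∑ j, ‖V t i j‖) + D) := by
        refine integral_mono (by linarith) (intervalIntegrable_coeffOp hV _ _).norm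
          ((hs.const_mul _).add intervalIntegrable_const) fun t => ?_
        have hpi : ‖fun i j => V t i j‖ ≤ ∑ i, ∑ j, ‖V t i j‖ := by
          refine (pi_norm_le_iff_of_nonneg (by positivity)).2 fun i => ?_
          refine le_trans ?_ (Finset.single_le_sum (f := fun i => ∑ j, ‖V t i j‖)
            (fun i _ => by positivity) (Finset.mem_univ i))
          refine (pi_norm_le_iff_of_nonneg (by positivity)).2 fun j => ?_
          exact Finset.single_le_sum (f := fun j => ‖V t i j‖) (fun j _ => by positivity)
            (Finset.mem_univ j)
        have e : coeffOp V z t = matrixOp n (V t)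
            - matrixOp n ((z • (1 : Matrix (Fin n) (Fin n) ℂ) : Matrix (Fin n) (Fin n) ℂ)) :=
          (matrixOp n).map_sub _ _
        simp only
        rw [e]
        refine (norm_sub_le _ _).trans ?_
        gcongr
        exact ((matrixOp n).le_opNorm fun i j => V t i j).trans (by gcongr)
    _ = ‖matrixOp n‖ * (∑ i, ∑ j, ∫ t in a..(a + 1), ‖V t i j‖) + D := by
        rw [intervalIntegral.integral_add (hs.const_mul _) intervalIntegrable_const,
          intervalIntegral.integral_const_mul, intervalIntegral.integral_finsetSum]
        · congr 2
          · refine Finset.sum_congr rfl fun i _ => ?_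
            rw [intervalIntegral.integral_finsetSum fun j _ => hVi i j]
          · simp
        · intro i _
          have := IntervalIntegrable.sum (μ := volume) (a := a) (b := a + 1) Finset.univ
            (f := fun j t => ‖V t i j‖) fun j _ => hVi i j
          simpa [Finset.sum_fn] using this
    _ ≤ _ := by
        gcongr with i _ j _
        exact hC a i j

lemma intervalIntegrable_sum_entry_mul (hV : IsPotential V) {g : Fin n → ℝ → ℂ} (hg : ∀ k, Continuous (g k))
    {a b : ℝ} (I J : Fin n → Fin n) :
    IntervalIntegrable (fun t => ∑ k, V t (I k) (J k) * g k t) volume a b := by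
  have := IntervalIntegrable.sum (μ := volume) (a := a) (b := b) Finset.univ
    (f := fun k t => V t (I k) (J k) * g k t) fun k _ =>
      (hV.intervalIntegrable _ _ a b).mul_continuousOn (hg k).continuousOn
  simpa [Finset.sum_fn] using this

/-- Applying `ψ` to a fixed vector yields a source-free vector solution, so the same Lagrange
identity serves for `ψ` and for the resolvent's output. -/
lemma IsSolution.solvesODE {ψ : ℝ → Matrix (Fin n) (Fin n) ℂ} (hV : IsPotential V)
    (hψ : IsSolution V z ψ) (e : EuclideanSpace ℂ (Fin n)) :
    SolvesODE (coeffOp V z) 0 (fun x => matrixOp n (ψ x) e) (fun x => matrixOp n (mderiv ψ x) e) := by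
  have hd := hasDerivAt_matrixOp hψ.1
  refine ⟨fun x => ?_, fun a b => ?_⟩
  · exact ((ContinuousLinearMap.apply ℝ _ e).hasFDerivAt.comp_hasDerivAt x (hd x))
  · have hψc : ∀ i j, Continuous fun t => ψ t i j := fun i j => (hψ.1 i j).continuous
    have hc : Continuous fun x => matrixOp n (ψ x) :=
      continuous_iff_continuousAt.2 fun x => (hd x).continuousAt
    have h1 := matrixOp_eq_integral (r := fun t => V t * ψ t - z • ψ t)
      (N := mderiv ψ b - mderiv ψ a) (a := a) (b := b) (fun i j => by
        simp only [Matrix.sub_apply, Matrix.smul_apply, Matrix.mul_apply]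
        exact (intervalIntegrable_sum_entry_mul hV (fun k => hψc k j) (fun _ => i) id).sub
          (Continuous.intervalIntegrable (by fun_prop) a b)) (hψ.2 a b)
    have e1 : ∀ t, matrixOp n (V t * ψ t - z • ψ t : Matrix (Fin n) (Fin n) ℂ)
        = coeffOp V z t ∘L matrixOp n (ψ t) := fun t => by
      rw [coeffOp, ← matrixOp_mul, sub_mul, smul_mul_assoc, one_mul]
    simp only [e1] at h1
    have h2 : IntervalIntegrable (fun t => coeffOp V z t ∘L matrixOp n (ψ t)) volume a b :=
      intervalIntegrable_comp hc (intervalIntegrable_coeffOp hV a b)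
    have h3 := DFunLike.congr_fun h1 e
    rw [ContinuousLinearMap.intervalIntegral_apply h2] at h3
    simp only [Pi.zero_apply, sub_zero]
    exact Eq.trans (DFunLike.congr_fun ((matrixOp n).map_sub _ _) e).symm h3

lemma IsAdjointSolution.solvesAdjointODE {φ : ℝ → Matrix (Fin n) (Fin n) ℂ} (hV : IsPotential V)
    (hφ : IsAdjointSolution V z φ) :
    SolvesAdjointODE (coeffOp V z) (fun x => matrixOp n (φ x)) (fun x => matrixOp n (mderiv φ x)) := by
  refine ⟨hasDerivAt_matrixOp hφ.1, fun a b => ?_⟩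
  have hφc : ∀ i j, Continuous fun t => φ t i j := fun i j => (hφ.1 i j).continuous
  have h1 := matrixOp_eq_integral (r := fun t => φ t * V t - z • φ t)
    (N := mderiv φ b - mderiv φ a) (a := a) (b := b) (fun i j => by
      simp only [Matrix.sub_apply, Matrix.smul_apply, Matrix.mul_apply, mul_comm (φ _ i _)]
      exact (intervalIntegrable_sum_entry_mul hV (fun k => hφc i k) id (fun _ => j)).sub
        (Continuous.intervalIntegrable (by fun_prop) a b)) (hφ.2 a b)
  have e1 : ∀ t, matrixOp n (φ t * V t - z • φ t : Matrix (Fin n) (Fin n) ℂ)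
      = matrixOp n (φ t) ∘L coeffOp V z t := fun t => by
    rw [coeffOp, ← matrixOp_mul, mul_sub, mul_smul_comm, mul_one]
  simp only [e1] at h1
  rw [← h1]
  exact ((matrixOp n).map_sub _ _).symm

lemma integrableOn_sq_norm_matrixOp {ψ : ℝ → Matrix (Fin n) (Fin n) ℂ} {s : Set ℝ}
    (h : ∀ i j, MemLp (fun x => ψ x i j) 2 (volume.restrict s)) :
    IntegrableOn (fun x => ‖matrixOp n (ψ x)‖ ^ 2) s := by
  have h1 : MemLp (fun x i j => ψ x i j) 2 (volume.restrict s) :=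
    MemLp.of_eval fun i => MemLp.of_eval fun j => h i j
  have h2 := (matrixOp n).comp_memLp' h1
  exact (memLp_two_iff_integrable_sq_norm h2.1).1 h2

end Matrix

/-! ### Wronskian relations and the Green kernel -/

section Green

variable {n : ℕ} {V : ℝ → Matrix (Fin n) (Fin n) ℂ} {z : ℂ}

/-- The term `z • v` moves into the coefficient: `V u - (z v + f) = (V - z) u - f` almost
everywhere. -/
lemma HamiltonianGraph.exists_solvesODE {v f : L2 n} (h : HamiltonianGraph V v (z • v + f)) :
    ∃ u : ℝ → EuclideanSpace ℂ (Fin n), v =ᵐ[volume] u ∧ MemLp u 2 volume ∧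
      SolvesODE (coeffOp V z) f u (deriv u) := by
  obtain ⟨u, hvu, hd, hi⟩ := h
  refine ⟨u, hvu, (memLp_congr_ae hvu).1 (Lp.memLp v), fun x => (hd x).hasDerivAt, fun a b => ?_⟩
  rw [hi]
  refine intervalIntegral.integral_congr_ae ?_
  filter_upwards [hvu, Lp.coeFn_add (z • v) f, Lp.coeFn_smul z v] with t h1 h2 h3 _
  rw [h2, Pi.add_apply, h3, Pi.smul_apply, h1, coeffOp, matrixOp_apply, map_sub, map_smul, map_one]
  simp only [sub_apply, smul_apply, one_apply_eq_self]
  abel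

lemma matrixOp_wronskian (φ ψ : ℝ → Matrix (Fin n) (Fin n) ℂ) (x : ℝ)
    (e : EuclideanSpace ℂ (Fin n)) :
    matrixOp n (φ x) (matrixOp n (mderiv ψ x) e) - matrixOp n (mderiv φ x) (matrixOp n (ψ x) e)
      = matrixOp n (wronskian φ ψ x) e := by
  have h : matrixOp n (wronskian φ ψ x) =
      matrixOp n (φ x * mderiv ψ x) - matrixOp n (mderiv φ x * ψ x) := (matrixOp n).map_sub _ _
  rw [h, matrixOp_mul, matrixOp_mul]
  rfl

/-- If the Wronskians of two pairs of solutions form the matrix `diag(1, -1)`, the fundamental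
matrix is inverted by the one of the adjoint solutions. -/
lemma completeness_of_wronskian {φm φp ψp ψm : ℝ → Matrix (Fin n) (Fin n) ℂ} {x : ℝ}
    (h₁ : wronskian φm ψp x = 1) (h₂ : wronskian φp ψm x = -1)
    (h₃ : wronskian φm ψm x = 0) (h₄ : wronskian φp ψp x = 0) :
    ψp x * φm x - ψm x * φp x = 0 ∧ ψm x * mderiv φp x - ψp x * mderiv φm x = 1 := by
  have h : Matrix.fromBlocks (φm x) (-mderiv φm x) (-φp x) (mderiv φp x)
      * Matrix.fromBlocks (mderiv ψp x) (mderiv ψm x) (ψp x) (ψm x) = 1 := by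
    rw [Matrix.fromBlocks_multiply, ← Matrix.fromBlocks_one]
    unfold wronskian at h₁ h₂ h₃ h₄
    congr 1
    · rw [← h₁, neg_mul, sub_eq_add_neg]
    · rw [← h₃, neg_mul, sub_eq_add_neg]
    · rw [← neg_eq_zero, ← h₄]; noncomm_ring
    · rw [← neg_inj, ← h₂]; noncomm_ring
  -- A left inverse of a square matrix is a right inverse; the second block row of the reversed
  -- product contains both claims.
  rw [mul_eq_one_comm, Matrix.fromBlocks_multiply, ← Matrix.fromBlocks_one,
    Matrix.fromBlocks_inj] at h
  refine ⟨?_, ?_⟩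
  · rw [← h.2.2.1]; noncomm_ring
  · rw [← h.2.2.2]; noncomm_ring

/-- Both solutions and their derivatives decay along `l`, so the constant Wronskian has limit zero
there. -/
lemma wronskian_eq_zero {φ ψ : ℝ → Matrix (Fin n) (Fin n) ℂ} (hV : IsPotential V)
    (hψ : IsSolution V z ψ) (hφ : IsAdjointSolution V z φ) {l : Filter ℝ} [l.NeBot]
    (hψl : Tendsto (fun a => ∫ t in a..(a + 1), ‖matrixOp n (ψ t)‖ ^ 2) l (𝓝 0))
    (hφl : Tendsto (fun a => ∫ t in a..(a + 1), ‖matrixOp n (φ t)‖ ^ 2) l (𝓝 0)) (x : ℝ) :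
    wronskian φ ψ x = 0 := by
  obtain ⟨K, hK⟩ := exists_integral_norm_coeffOp_le (z := z) hV
  have hQ := intervalIntegrable_coeffOp (z := z) hV
  have hΦ := hφ.solvesAdjointODE hV
  have hΦ0 := hΦ.tendsto_zero hQ hK hφl
  refine matrixOp_injective (ContinuousLinearMap.ext fun e => ?_)
  have hu := hψ.solvesODE hV e
  have hc : Continuous fun x => matrixOp n (ψ x) :=
    continuous_iff_continuousAt.2 fun x => (hasDerivAt_matrixOp hψ.1 x).continuousAt
  have hS : Tendsto (fun a => ∫ t in a..(a + 1), ‖matrixOp n (ψ t) e‖ ^ 2) l (𝓝 0) := by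
    have h := hψl.mul_const (‖e‖ ^ 2)
    rw [zero_mul] at h
    refine squeeze_zero (fun a => integral_nonneg (by linarith) fun t _ => by positivity)
      (fun a => ?_) h
    rw [← intervalIntegral.integral_mul_const]
    refine integral_mono (by linarith) (Continuous.intervalIntegrable (by fun_prop) _ _)
      (Continuous.intervalIntegrable (by fun_prop) _ _) fun t => ?_
    rw [← mul_pow]
    gcongr
    exact (matrixOp n (ψ t)).le_opNorm e
  have hu0 := hu.tendsto_zero hQ hK (fun _ _ => intervalIntegrable_const) hS
    (by simp)
  have h := wronskian_eq_zero_of_tendsto hΦ hu hQ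
    (tendsto_wronskian_zero hΦ0.1 hΦ0.2 hu0.1 hu0.2) x
  rw [matrixOp_wronskian] at h
  rw [h]
  exact (DFunLike.congr_fun (map_zero (matrixOp n)) e).symm

/-- The candidate for the Green's function. -/
noncomputable def greenKernel (ψp ψm φp φm : ℝ → Matrix (Fin n) (Fin n) ℂ) (x y : ℝ) :
    Matrix (Fin n) (Fin n) ℂ :=
  -(heaviside (x - y) • (ψp x * φm y)) - heaviside (y - x) • (ψm x * φp y)

variable {ψp ψm φp φm : ℝ → Matrix (Fin n) (Fin n) ℂ}

lemma greenKernel_of_lt {x y : ℝ} (h : y < x) :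
    greenKernel ψp ψm φp φm x y = -(ψp x * φm y) := by
  have h1 : 0 < x - y := by linarith
  have h2 : ¬ 0 < y - x := by linarith
  have h3 : y - x < 0 := by linarith
  simp [greenKernel, heaviside, h1, h2, h3]

lemma greenKernel_of_gt {x y : ℝ} (h : x < y) :
    greenKernel ψp ψm φp φm x y = -(ψm x * φp y) := by
  have h1 : 0 < y - x := by linarith
  have h2 : ¬ 0 < x - y := by linarith
  have h3 : x - y < 0 := by linarith
  simp [greenKernel, heaviside, h1, h2, h3]

lemma continuous_greenKernel (hψp : Continuous ψp) (hψm : Continuous ψm) (hφp : Continuous φp)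
    (hφm : Continuous φm) (hdiag : ∀ x, ψp x * φm x = ψm x * φp x) :
    Continuous fun p : ℝ × ℝ => greenKernel ψp ψm φp φm p.1 p.2 := by
  have h : (fun p : ℝ × ℝ => greenKernel ψp ψm φp φm p.1 p.2)
      = fun p => if p.2 ≤ p.1 then -(ψp p.1 * φm p.2) else -(ψm p.1 * φp p.2) := by
    funext ⟨x, y⟩
    rcases lt_trichotomy y x with hyx | rfl | hyx
    · simp [greenKernel_of_lt hyx, hyx.le]
    -- On the diagonal the two halves from `θ(0) = 1/2` add up to the common value of both branches.
    · simp only [greenKernel, heaviside, sub_self, lt_irrefl, if_false, le_refl, if_true, hdiag]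
      rw [← neg_add', ← add_smul]
      norm_num
    · simp [greenKernel_of_gt hyx, hyx]
  rw [h]
  refine Continuous.if_le ?_ ?_ continuous_snd continuous_fst ?_
  · exact ((hψp.comp continuous_fst).matrix_mul (hφm.comp continuous_snd)).neg
  · exact ((hψm.comp continuous_fst).matrix_mul (hφp.comp continuous_snd)).neg
  · intro p hp
    rw [hp, hdiag]

/-- The diagonal point `y = x` is null, so the value of `θ(0)` does not affect the integral. -/
lemma greenKernel_ae_eq (x : ℝ) (f : ℝ → EuclideanSpace ℂ (Fin n)) :
    (fun y => Matrix.toEuclideanCLM (𝕜 := ℂ) (greenKernel ψp ψm φp φm x y) (f y)) =ᵐ[volume]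
      fun y => (Iic x).indicator (fun y => -matrixOp n (ψp x) (matrixOp n (φm y) (f y))) y
        + (Ioi x).indicator (fun y => -matrixOp n (ψm x) (matrixOp n (φp y) (f y))) y := by
  filter_upwards [compl_mem_ae_iff.2 (measure_singleton x)] with y hy
  rcases lt_or_gt_of_ne (show y ≠ x from hy) with h | h
  · rw [greenKernel_of_lt h, indicator_of_mem (show y ∈ Iic x from h.le),
      indicator_of_notMem (show y ∉ Ioi x from h.not_gt), add_zero, map_neg, map_mul]
    rfl
  · rw [greenKernel_of_gt h, indicator_of_notMem (show y ∉ Iic x from h.not_ge),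
      indicator_of_mem (show y ∈ Ioi x from h), zero_add, map_neg, map_mul]
    rfl

lemma integrable_greenKernel_apply {x : ℝ} {f : ℝ → EuclideanSpace ℂ (Fin n)}
    (hm : IntegrableOn (fun y => matrixOp n (φm y) (f y)) (Iic x))
    (hp : IntegrableOn (fun y => matrixOp n (φp y) (f y)) (Ioi x)) :
    Integrable fun y => Matrix.toEuclideanCLM (𝕜 := ℂ) (greenKernel ψp ψm φp φm x y) (f y) := by
  refine Integrable.congr ?_ (greenKernel_ae_eq x f).symm
  exact ((integrable_indicator_iff measurableSet_Iic).2 ((matrixOp n (ψp x)).integrable_comp hm).neg).add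
    ((integrable_indicator_iff measurableSet_Ioi).2 ((matrixOp n (ψm x)).integrable_comp hp).neg)

lemma integral_greenKernel_apply {x : ℝ} {f : ℝ → EuclideanSpace ℂ (Fin n)}
    (hm : IntegrableOn (fun y => matrixOp n (φm y) (f y)) (Iic x))
    (hp : IntegrableOn (fun y => matrixOp n (φp y) (f y)) (Ioi x)) :
    ∫ y, Matrix.toEuclideanCLM (𝕜 := ℂ) (greenKernel ψp ψm φp φm x y) (f y)
      = -matrixOp n (ψp x) (∫ y in Iic x, matrixOp n (φm y) (f y))
        - matrixOp n (ψm x) (∫ y in Ioi x, matrixOp n (φp y) (f y)) := by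
  have h1 : Integrable ((Iic x).indicator
      fun y => -matrixOp n (ψp x) (matrixOp n (φm y) (f y))) :=
    (integrable_indicator_iff measurableSet_Iic).2 ((matrixOp n (ψp x)).integrable_comp hm).neg
  have h2 : Integrable ((Ioi x).indicator
      fun y => -matrixOp n (ψm x) (matrixOp n (φp y) (f y))) :=
    (integrable_indicator_iff measurableSet_Ioi).2 ((matrixOp n (ψm x)).integrable_comp hp).neg
  rw [integral_congr_ae (greenKernel_ae_eq x f), MeasureTheory.integral_add h1 h2,
    MeasureTheory.integral_indicator measurableSet_Iic,
    MeasureTheory.integral_indicator measurableSet_Ioi,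
    MeasureTheory.integral_neg, MeasureTheory.integral_neg,
    (matrixOp n (ψp x)).integral_comp_comm hm, (matrixOp n (ψm x)).integral_comp_comm hp,
    sub_eq_add_neg]

end Green

end MatrixSchrodinger

open MatrixSchrodinger Filter Set Topology in
theorem lemmaC2 (n : ℕ) (V : ℝ → Matrix (Fin n) (Fin n) ℂ)
    (hV : MatrixSchrodinger.IsPotential V)
    (z : ℂ) (hz : z ∉ MatrixSchrodinger.spectrumH V)
    (ψp ψm φp φm : ℝ → Matrix (Fin n) (Fin n) ℂ)
    (hψp : MatrixSchrodinger.IsSolution V z ψp) (hψp_top : MatrixSchrodinger.L2AtTop ψp)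
    (hψm : MatrixSchrodinger.IsSolution V z ψm) (hψm_bot : MatrixSchrodinger.L2AtBot ψm)
    (hφp : MatrixSchrodinger.IsAdjointSolution V z φp) (hφp_top : MatrixSchrodinger.L2AtTop φp)
    (hφm : MatrixSchrodinger.IsAdjointSolution V z φm) (hφm_bot : MatrixSchrodinger.L2AtBot φm)
    (hW₁ : ∀ x, MatrixSchrodinger.wronskian φm ψp x = 1)
    (hW₂ : ∀ x, MatrixSchrodinger.wronskian φp ψm x = -1) :
    MatrixSchrodinger.IsGreensFunction V z (fun x x' =>
      -(MatrixSchrodinger.heaviside (x - x') • (ψp x * φm x'))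
        - MatrixSchrodinger.heaviside (x' - x) • (ψm x * φp x')) := by
  obtain ⟨K, hK⟩ := exists_integral_norm_coeffOp_le (z := z) hV
  have hQ := intervalIntegrable_coeffOp (z := z) hV
  have hc : ∀ {ψ : ℝ → Matrix (Fin n) (Fin n) ℂ}, (∀ i j, Differentiable ℝ fun x => ψ x i j) →
      Continuous ψ := fun h => continuous_matrix fun i j => (h i j).continuous
  have hcop : ∀ {ψ : ℝ → Matrix (Fin n) (Fin n) ℂ}, (∀ i j, Differentiable ℝ fun x => ψ x i j) →
      Continuous fun x => ‖matrixOp n (ψ x)‖ ^ 2 := fun h =>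
    (continuous_iff_continuousAt.2 fun x => (hasDerivAt_matrixOp h x).continuousAt).norm.pow 2
  have htop : ∀ {ψ : ℝ → Matrix (Fin n) (Fin n) ℂ}, (∀ i j, Differentiable ℝ fun x => ψ x i j) →
      L2AtTop ψ → ∀ x, IntegrableOn (fun t => ‖matrixOp n (ψ t)‖ ^ 2) (Ioi x) := fun hd h x =>
    integrableOn_Ioi_of_Ioi (hcop hd) (integrableOn_sq_norm_matrixOp h) x
  have hbot : ∀ {ψ : ℝ → Matrix (Fin n) (Fin n) ℂ}, (∀ i j, Differentiable ℝ fun x => ψ x i j) →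
      L2AtBot ψ → ∀ x, IntegrableOn (fun t => ‖matrixOp n (ψ t)‖ ^ 2) (Iic x) := fun hd h x =>
    integrableOn_Iic_of_Iio (hcop hd) (integrableOn_sq_norm_matrixOp h) x
  have ltop : ∀ {ψ : ℝ → Matrix (Fin n) (Fin n) ℂ}, (∀ i j, Differentiable ℝ fun x => ψ x i j) →
      L2AtTop ψ → Tendsto (fun a => ∫ t in a..(a + 1), ‖matrixOp n (ψ t)‖ ^ 2) atTop (𝓝 0) :=
    fun hd h => tendsto_integral_unit_atTop (fun a b => (hcop hd).intervalIntegrable a b)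
      (htop hd h 0)
  have lbot : ∀ {ψ : ℝ → Matrix (Fin n) (Fin n) ℂ}, (∀ i j, Differentiable ℝ fun x => ψ x i j) →
      L2AtBot ψ → Tendsto (fun a => ∫ t in a..(a + 1), ‖matrixOp n (ψ t)‖ ^ 2) atBot (𝓝 0) :=
    fun hd h => tendsto_integral_unit_atBot (fun a b => (hcop hd).intervalIntegrable a b)
      (hbot hd h 0)
  have hW₃ := wronskian_eq_zero hV hψm hφm (lbot hψm.1 hψm_bot) (lbot hφm.1 hφm_bot)
  have hW₄ := wronskian_eq_zero hV hψp hφp (ltop hψp.1 hψp_top) (ltop hφp.1 hφp_top)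
  have hcompl := fun x => completeness_of_wronskian (hW₁ x) (hW₂ x) (hW₃ x) (hW₄ x)
  refine ⟨continuous_greenKernel (hc hψp.1) (hc hψm.1) (hc hφp.1) (hc hφm.1)
    fun x => sub_eq_zero.1 (hcompl x).1, ?_⟩
  obtain ⟨R, hR⟩ := not_not.1 hz
  have hΦp := hφp.solvesAdjointODE hV
  have hΦm := hφm.solvesAdjointODE hV
  refine ⟨R, hR, fun f => ?_⟩
  have hf2 : MemLp f 2 volume := Lp.memLp f
  have him : ∀ x, IntegrableOn (fun y => matrixOp n (φm y) (f y)) (Iic x) := fun x =>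
    integrableOn_apply hΦm.continuous (hbot hφm.1 hφm_bot x) hf2
  have hip : ∀ x, IntegrableOn (fun y => matrixOp n (φp y) (f y)) (Ioi x) := fun x =>
    integrableOn_apply hΦp.continuous (htop hφp.1 hφp_top x) hf2
  refine ⟨fun x => integrable_greenKernel_apply (him x) (hip x), ?_⟩
  obtain ⟨u, hRu, hu2, hu⟩ := (hR.right_inv f).exists_solvesODE
  have hfi : ∀ a b, IntervalIntegrable f volume a b := fun a b =>
    ((hf2.locallyIntegrable (by norm_num)).integrableOn_isCompact isCompact_uIcc).intervalIntegrable
  have hu0 := hu.tendsto_zero_of_memLp hQ hK hf2 hu2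
  have hp0 := hΦp.tendsto_zero hQ hK (ltop hφp.1 hφp_top)
  have hm0 := hΦm.tendsto_zero hQ hK (lbot hφm.1 hφm_bot)
  filter_upwards [hRu] with x hx
  have em := wronskian_eq_integral_Iic hΦm hu hQ hfi
    (tendsto_wronskian_zero hm0.1 hm0.2 hu0.2.1 hu0.2.2) (him x)
  have ep := wronskian_eq_integral_Ioi hΦp hu hQ hfi
    (tendsto_wronskian_zero hp0.1 hp0.2 hu0.1.1 hu0.1.2) (hip x)
  have hint := integral_greenKernel_apply (ψp := ψp) (ψm := ψm) (him x) (hip x)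
  -- The integral is now ψ₊ W(φ₋, u) - ψ₋ W(φ₊, u) at `x`. Below, `c1` cancels the terms in `u'` and
  -- `c2` reduces the terms in `u` to `u x`.
  rw [← map_neg, ← em, ← ep] at hint
  refine (hx.trans ?_).trans hint.symm
  have hmul : ∀ (M N : Matrix (Fin n) (Fin n) ℂ) (e : EuclideanSpace ℂ (Fin n)),
      matrixOp n M (matrixOp n N e) = Matrix.toEuclideanCLM (𝕜 := ℂ) (M * N) e := fun M N e => by
    rw [map_mul]; rfl
  simp only [map_sub, hmul]
  have c1 : Matrix.toEuclideanCLM (𝕜 := ℂ) (ψp x * φm x) =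
      Matrix.toEuclideanCLM (𝕜 := ℂ) (ψm x * φp x) :=
    congrArg _ (sub_eq_zero.1 (hcompl x).1)
  have c2 := congrArg (fun M => Matrix.toEuclideanCLM (𝕜 := ℂ) M (u x)) (hcompl x).2
  simp only [map_sub, map_one, sub_apply, one_apply_eq_self] at c2
  rw [c1]
  refine c2.symm.trans ?_
  abel
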